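/- **Setting.** Let $\Sigma$ be a finite alphabet with at least two elements; $\log$ denotes $\log_{|\Sigma|}$ and $-\log 0=+\infty$. A set of strings is *prefix-free* if no member is a proper prefix of another. An *encoding* of a set is an injection into $\Sigma^*$ with decidable image. Fix a self-delimiting encoding $\overline{\,\cdot\,}:\Sigma^*\to\Sigma^*$ (total computable, injective, with decidable prefix-free image); tuples are encoded by $\langle s_0,\dots,s_m\rangle=\overline{s_0}\cdots\overline{s_{m-1}}\,s_m$. Fix encodings of $\mathbb N$, $\mathbb Q$, $\{0,1\}$ and $\{0,\dots,n-1\}^*$ ($n\in\mathbb N$), all of them computable functions, and encodings $\mathrm{Enc}_{\mathcal X},\mathrm{Enc}_{\mathcal Y}$ of the sets $\mathcal X,\mathcal Y$ below. (Partial) computability of functions between encoded sets means that they are induced on codes by a partial computable function $\Sigma^*\rightharpoonup\Sigma^*$. *Universal machine.* A partial computable $U:\Sigma^*\rightharpoonup\Sigma^*$ for which there is a decidable prefix-free set $\mathsf{Programs}\subseteq\Sigma^*$ such that for every partial computable $f:\Sigma^*\rightharpoonup\Sigma^*$ some $p\in\mathsf{Programs}$ satisfies $U(\overline{x}\,p\,w)=f(\overline{x}\,w)$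 for all $x,w\in\Sigma^*$ (equality including domains). Put $C_U(y\mid x)=\min\{|p| : U(\overline{\mathrm{Enc}_{\mathcal X}(x)}\,p)=\mathrm{Enc}_{\mathcal Y}(y)\}$. *Explanations.* Let $\Lambda$ be a finite set of characters with an injective code $\Lambda\to\Sigma^*$ whose image is prefix-free, let $L_\Lambda$ be the maximal length of a code word, and encode $\Lambda^*$ by concatenating code words. An *interpretation function* is a partial computable function $I:\Lambda^*\times\mathbb N\times\mathcal Y\rightharpoonup\mathbb Q$. A string $e\in\Lambda^*$ is a *completely faithful explanation* of $g:\mathcal Y\to\mathbb R$ if for all $y\in\mathcal Y$ and $k\in\mathbb N$ the value $I(e,k,y)$ is defined and $|I(e,k,y)-g(y)|<|\Sigma|^{-k}$. *Stochastic input-output AI.* Such an $A$ with domain $\mathcal X'\subseteq\mathcal X$ consists of an $n\in\mathbb N$ and partial computable functions $f:\{0,\dots,n-1\}^*\times\mathcal X\rightharpoonup\mathcal Y$ and $\tau:\{0,\dots,n-1\}^*\times\mathcal X\rightharpoonup\{0,1\}$ such that: $f(u,x)$ is undefined for all $u$ if $x\notin\mathcal X'$; for $x\in\mathcal X'$, $\tau(u,x)$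 is defined for all $u$, the set $\mathcal T_x=\{u:\tau(u,x)=1\}$ is prefix-free, and $f(u,x)$ is defined for all $u\in\mathcal T_x$; and there is a computable $N:\mathcal X'\times\mathbb N\to\mathbb N$ with $1-\sum_{u\in\mathcal T_x,\,|u|\le N(x,k)}n^{-|u|}\le|\Sigma|^{-k}$ for all $x\in\mathcal X'$, $k\in\mathbb N$. For $x\in\mathcal X'$ put $Q_A(y\mid x)=\sum_{u\in\mathcal T_x,\ f(u,x)=y}n^{-|u|}$. **Theorem (Fundamental Quadrilemma).** Fix a universal machine $U$, an encoded set $\mathcal Y$, a character set $\Lambda$ with its code, and an interpretation function $I$ as above. There is a constant $c\in\mathbb R$ such that for every encoded set $\mathcal X$ and every stochastic input-output AI $A$ with input space $\mathcal X$, output space $\mathcal Y$ and domain $\mathcal X'\subseteq\mathcal X$: (i) for all $x\in\mathcal X'$, $y\in\mathcal Y$ and every completely faithful explanation $e_x\in\Lambda^*$ of $Q_A(\cdot\mid x)$, $$-\log Q_A(y\mid x)+L_\Lambda|e_x|+2\log(L_\Lambda|e_x|+1)\ \ge\ C_U(y\mid x)+c;$$ (ii) if for every $x\in\mathcal X'$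 a completely faithful explanation $e_x\in\Lambda^*$ of $Q_A(\cdot\mid x)$ is given, then for every probability distribution $P$ on $\mathcal X'\times\mathcal Y$, $$\mathbb E_{(X,Y)\sim P}[-\log Q_A(Y\mid X)]+\mathbb E_{(X,Y)\sim P}\big[L_\Lambda|e_X|+2\log(L_\Lambda|e_X|+1)\big]\ \ge\ \mathbb E_{(X,Y)\sim P}[C_U(Y\mid X)]+c$$ as an inequality of extended real numbers. -/

import Mathlib

open scoped ENNReal

noncomputable section

namespace Quadrilemma

/-- A set of strings none of whose members properly extends another member. -/
def IsPrefixFree {A : Type*} (F : Set (List A)) : Prop :=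
  ∀ c ∈ F, ∀ z : List A, z ≠ [] → c ++ z ∉ F

section Computability

/- `S` is the (finite) alphabet of the computation model. Any two `Primcodable` structures on a
finite type give the same computable functions on `List S`. -/
variable {S : Type*} [Primcodable S]

/-- Encoding function of a set `Z`: injective, with decidable image. -/
def IsEncoding {Z : Type*} (enc : Z → List S) : Prop :=
  Function.Injective enc ∧ ComputablePred (fun s : List S => s ∈ Set.range enc)

/-- Self-delimiting encoding function `s ↦ s̄`: total computable, injective, with decidable
prefix-free image. -/
def IsSelfDelimiting (bar : List S → List S) : Prop :=
  Computable bar ∧ IsEncoding bar ∧ IsPrefixFree (Set.range bar)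

/-- Partial computability of `f : ⊆ Z → W` relative to string codes of `Z` and `W`; the equation is
one of partial values, so it includes the domains. -/
def PartialComputable {Z W : Type*} (encZ : Z → List S) (encW : W → List S) (f : Z →. W) : Prop :=
  ∃ g : List S →. List S, Partrec g ∧ ∀ z, g (encZ z) = (f z).map encW

/-- A computable encoding of the rationals: the code of `(a - b) / (c + 1)` can be computed from the
natural numbers `a`, `b`, `c`. -/
def ComputableRatEncoding (encQ : ℚ → List S) : Prop :=
  Computable fun t : ℕ × ℕ × ℕ => encQ (((t.1 : ℚ) - (t.2.1 : ℚ)) / ((t.2.2 : ℚ) + 1))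

/-- Code of a pair, `⟨a, b⟩ ↦ (code of a)‾ · (code of b)`. -/
def encPair {S : Type*} {Z W : Type*} (bar : List S → List S) (encZ : Z → List S)
    (encW : W → List S) (p : Z × W) : List S :=
  bar (encZ p.1) ++ encW p.2

/-- Universal conditional partial computable function. -/
def IsUniversalConditional (bar : List S → List S) (U : List S →. List S) : Prop :=
  Partrec U ∧ ∃ programs : Set (List S),
    ComputablePred (fun p : List S => p ∈ programs) ∧ IsPrefixFree programs ∧
      ∀ f : List S →. List S, Partrec f →
        ∃ p ∈ programs, ∀ x w : List S, U (bar x ++ p ++ w) = f (bar x ++ w)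

end Computability

/-- Conditional plain Kolmogorov complexity of the string `y` given the string `x`. For universal
`U` the set is nonempty, so this is a minimum. -/
def plainComplexity {S : Type*} (bar : List S → List S) (U : List S →. List S)
    (y x : List S) : ℕ :=
  sInf {m | ∃ p : List S, y ∈ U (bar x ++ p) ∧ p.length = m}

section Explanations

variable {S L : Type*}

/-- Character-by-character code of a string over the explanation alphabet `L`. -/
def encString (encL : L → List S) (e : List L) : List S := (e.map encL).flatten

/-- Maximal code length of a character. -/
def maxCodeLength [Fintype L] (encL : L → List S) : ℕ :=
  Finset.univ.sup fun a => (encL a).length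

/-- `e` is a completely faithful explanation of `f` under the interpretation function `I`: for all
`z` and `k`, `I (e, k, z)` is defined and lies within `|S| ^ (-k)` of `f z`. -/
def IsFaithfulExplanation (S : Type*) [Fintype S] {Z : Type*} (I : List L × ℕ × Z →. ℚ)
    (e : List L) (f : Z → ℝ) : Prop :=
  ∀ (z : Z) (k : ℕ), ∃ q ∈ I (e, k, z), |(q : ℝ) - f z| < ((Fintype.card S : ℝ) ^ k)⁻¹

end Explanations

/-- Stochastic input-output AI with input space `X` and output space `Y`. The maps `encX`, `encY`,
`encN`, `encB`, `encR n` are the codes of `X`, `Y`, `ℕ`, `{0, 1}` and `{0, …, n - 1}*`. -/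
structure StochasticAI {S X Y : Type*} [Primcodable S] [Fintype S] (bar : List S → List S)
    (encX : X → List S) (encY : Y → List S) (encN : ℕ → List S) (encB : Bool → List S)
    (encR : ∀ n : ℕ, List (Fin n) → List S) where
  /-- the domain -/
  dom : Set X
  /-- the number of values of the uniform random numbers -/
  n : ℕ
  /-- the main function -/
  main : List (Fin n) × X →. Y
  /-- the random-sequence acceptance decision function -/
  accept : List (Fin n) × X →. Bool
  main_computable : PartialComputable (encPair bar (encR n) encX) encY main
  accept_computable : PartialComputable (encPair bar (encR n) encX) encB accept
  main_undefined : ∀ x ∉ dom, ∀ u, ¬ (main (u, x)).Dom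
  accept_defined : ∀ x ∈ dom, ∀ u, (accept (u, x)).Dom
  accepted_prefixFree : ∀ x ∈ dom, IsPrefixFree {u | true ∈ accept (u, x)}
  /-- constructive stopping guarantee, with the computable bound `N` on the domain -/
  stopping : ∃ N : dom × ℕ → ℕ,
    PartialComputable (encPair bar (fun x : dom => encX x) encN) encN (N : dom × ℕ →. ℕ) ∧
      ∀ (x : dom) (k : ℕ),
        1 - ∑' u : {u : List (Fin n) // true ∈ accept (u, (x : X)) ∧ u.length ≤ N (x, k)},
            ((n : ℝ≥0∞)⁻¹) ^ u.1.length ≤ ((Fintype.card S : ℝ≥0∞)⁻¹) ^ k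
  main_defined : ∀ x ∈ dom, ∀ u, true ∈ accept (u, x) → (main (u, x)).Dom

/-- `A.prob x y` is `Q_A(y | x)`: the sum of `n ^ (-|u|)` over the accepted random sequences `u` with
`main (u, x) = y`. It is meaningful for `x ∈ A.dom`. -/
def StochasticAI.prob {S X Y : Type*} [Primcodable S] [Fintype S] {bar : List S → List S}
    {encX : X → List S} {encY : Y → List S} {encN : ℕ → List S} {encB : Bool → List S}
    {encR : ∀ n : ℕ, List (Fin n) → List S} (A : StochasticAI bar encX encY encN encB encR)
    (x : X) (y : Y) : ℝ≥0∞ :=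
  ∑' u : {u : List (Fin A.n) // true ∈ A.accept (u, x) ∧ y ∈ A.main (u, x)},
    ((A.n : ℝ≥0∞)⁻¹) ^ u.1.length

/-- `-log_b q`, equal to `+∞` at `q = 0` (used for `q ≤ 1`). -/
def negLog (b : ℕ) (q : ℝ≥0∞) : EReal :=
  if q = 0 then ⊤ else ((-Real.logb b q.toReal : ℝ) : EReal)

/-- Expectation of an extended real function under a discrete distribution, as the expectation of
the positive part minus that of the negative part. -/
def expect {Z : Type*} (P : PMF Z) (F : Z → EReal) : EReal :=
  ((∑' z, P z * (F z).toENNReal : ℝ≥0∞) : EReal) -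
    ((∑' z, P z * (-F z).toENNReal : ℝ≥0∞) : EReal)

end Quadrilemma

end

/-!
An explanation `e` of `Q_A(· | x)` makes every probability `Q_A(y | x)` computable to any
precision. By Kraft's inequality these probabilities sum to at most `1`, so at most `|S| ^ k`
outputs have probability `|S| ^ (-k)` or more, and those whose approximate probability exceeds a
slightly larger threshold can be enumerated from `e` and `k`. Hence `y` is determined by a code of
`e`, made self-delimiting at the cost of `2 log (|e| + 1)` letters, and by an index of
`-log Q_A(y | x) + O(1)` letters. Universality of the machine turns this description into a bound
on the complexity of `y` given `x`, which is then integrated against `P`.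
-/

namespace Quadrilemma

section Search

variable {α σ : Type*} [Primcodable α] [Primcodable σ]

theorem exists_partrec_section {f : α → σ} (hf : Computable f) :
    ∃ g : σ →. α, Partrec g ∧ ∀ a, ∃ a' ∈ g (f a), f a' = f a := by
  classical
  let search : σ → ℕ → Option α := fun s n =>
    (Encodable.decode (α := α) n).bind fun a => cond (decide (f a = s)) (some a) none
  have hsearch : Computable₂ search := by
    have heq : Computable₂ fun s t : σ => decide (s = t) := Primrec.eq.decide.to_comp
    exact Computable.option_bind (Computable.decode.comp Computable.snd)
      (Computable.cond
        (heq.comp (hf.comp Computable.snd) (Computable.fst.comp Computable.fst))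
        (Computable.option_some.comp Computable.snd) (Computable.const none))
  refine ⟨fun s => Nat.rfindOpt (search s), Partrec.rfindOpt hsearch, fun a => ?_⟩
  have hdom : (Nat.rfindOpt (search (f a))).Dom :=
    Nat.rfindOpt_dom.2 ⟨Encodable.encode a, a, by simp [search]⟩
  obtain ⟨a', ha'⟩ := Part.dom_iff_mem.1 hdom
  obtain ⟨n, hn⟩ := Nat.rfindOpt_spec ha'
  obtain ⟨a'', -, h⟩ := Option.bind_eq_some_iff.1 hn
  refine ⟨a', ha', ?_⟩
  by_cases heq : f a'' = f a <;> simp_all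

theorem exists_partrec_leftInverse {f : α → σ} (hf : Computable f)
    (hinj : Function.Injective f) : ∃ g : σ →. α, Partrec g ∧ ∀ a, a ∈ g (f a) := by
  obtain ⟨g, hg, hgf⟩ := exists_partrec_section hf
  refine ⟨g, hg, fun a => ?_⟩
  obtain ⟨a', ha', heq⟩ := hgf a
  exact hinj heq ▸ ha'

/-- The number of `m < n` accepted by the partial test `P`, as a partial value: it is defined once
`P` halts below `n`. -/
def partCount (P : ℕ →. Bool) : ℕ → Part ℕ
  | 0 => Part.some 0
  | n + 1 => (partCount P n).bind fun c => (P n).map fun b => cond b (c + 1) c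

theorem partCount_eq_count {P : ℕ →. Bool} {p : ℕ → Prop} [DecidablePred p]
    (hP : ∀ n, P n = Part.some (decide (p n))) (n : ℕ) :
    partCount P n = Part.some (Nat.count p n) := by
  induction n with
  | zero => simp [partCount]
  | succ n ih =>
    rw [partCount, ih, Part.bind_some, hP, Part.map_some, Nat.count_succ]
    by_cases hn : p n <;> simp [hn]

theorem partrec₂_partCount {P : α → ℕ →. Bool} (hP : Partrec₂ P) :
    Partrec₂ fun a => partCount (P a) := by
  have hc : Computable fun q : ((α × ℕ) × ℕ × ℕ) × Bool => q.1.2.2 :=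
    Computable.snd.comp (Computable.snd.comp Computable.fst)
  refine (Partrec.nat_rec (f := fun q : α × ℕ => q.2) (g := fun _ => Part.some 0)
    (h := fun q r => (P q.1 r.1).map fun b => cond b (r.2 + 1) r.2)
    Computable.snd (Computable.const 0) (Partrec.map (hP.comp
      (Computable.fst.comp Computable.fst) (Computable.fst.comp Computable.snd))
      (Computable.cond Computable.snd (Computable.succ.comp hc) hc))).of_eq ?_
  rintro ⟨a, n⟩
  induction n with
  | zero => rfl
  | succ n ih => exact congrArg (Part.bind · _) ih

/-- The `j`-th number (counting from `0`) accepted by the partial test `P`, found by unbounded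
search; a partial version of `Nat.nth`. -/
def partNth (P : ℕ →. Bool) (j : ℕ) : Part ℕ :=
  Nat.rfind fun n => (partCount P n).bind fun c => (P n).map fun b => b && decide (c = j)

theorem mem_partNth_count {P : ℕ →. Bool} {p : ℕ → Prop} [DecidablePred p]
    (hP : ∀ n, P n = Part.some (decide (p n))) {n : ℕ} (hn : p n) :
    n ∈ partNth P (Nat.count p n) := by
  simp only [partNth, partCount_eq_count hP, hP, Part.bind_some, Part.map_some]
  refine Nat.mem_rfind.2 ⟨by simp [hn], fun {m} hm => Part.mem_some_iff.2 ?_⟩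
  have hne : ¬ (p m ∧ Nat.count p m = Nat.count p n) :=
    fun h => hm.ne (Nat.count_injective h.1 hn h.2)
  simpa using hne

theorem partrec₂_partNth {P : α → ℕ →. Bool} (hP : Partrec₂ P) :
    Partrec₂ fun a => partNth (P a) := by
  refine Partrec.rfind (p := fun (q : α × ℕ) n =>
    (partCount (P q.1) n).bind fun c => (P q.1 n).map fun b => b && decide (c = q.2)) ?_
  refine Partrec.bind ((partrec₂_partCount hP).comp
    (Computable.fst.comp Computable.fst) Computable.snd) (Partrec.map (hP.comp
      (Computable.fst.comp (Computable.fst.comp Computable.fst))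
      (Computable.snd.comp Computable.fst)) ?_)
  exact (Primrec.and.comp Primrec.snd (Primrec.eq.comp (Primrec.snd.comp Primrec.fst)
    (Primrec.snd.comp (Primrec.fst.comp (Primrec.fst.comp Primrec.fst)))).decide).to_comp

theorem exists_partrec_index_lt_card {P : α → σ →. Bool} (hP : Partrec₂ P) [DecidableEq σ] :
    ∃ F : α → ℕ →. σ, Partrec₂ F ∧ ∀ (a : α) (T : Finset σ),
      (∀ s, P a s = Part.some (decide (s ∈ T))) → ∀ s ∈ T, ∃ j < T.card, s ∈ F a j := by
  classical
  let test : α → ℕ →. Bool := fun a n =>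
    Option.casesOn (motive := fun _ => Part Bool) (Encodable.decode₂ σ n) (Part.some false) (P a)
  have htest : Partrec₂ test :=
    Partrec.optionCasesOn_right (o := fun q : α × ℕ => Encodable.decode₂ σ q.2)
      (f := fun _ => false) (g := fun q s => P q.1 s)
      (Primrec.decode₂.to_comp.comp Computable.snd) (Computable.const false)
      (hP.comp (Computable.fst.comp Computable.fst) Computable.snd)
  refine ⟨fun a j => (partNth (test a) j).bind fun n => (Encodable.decode (α := σ) n : Part σ),
    (partrec₂_partNth htest).bind (Computable.ofOption (Computable.decode.comp Computable.snd)),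
    fun a T hT s hs => ?_⟩
  set C := T.map ⟨Encodable.encode, Encodable.encode_injective⟩ with hC
  have htest_eq : ∀ n, test a n = Part.some (decide (n ∈ C)) := by
    intro n
    rcases hn : Encodable.decode₂ σ n with _ | t
    · have : n ∉ C := by
        rintro h
        obtain ⟨t, -, rfl⟩ := Finset.mem_map.1 h
        simp at hn
      simp [test, hn, this]
    · obtain rfl := Encodable.mem_decode₂.1 hn
      simp [test, hT, hC]
  have hsC : Encodable.encode s ∈ C := Finset.mem_map_of_mem _ hs
  refine ⟨Nat.count (· ∈ C) (Encodable.encode s), ?_,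
    Part.mem_bind (mem_partNth_count htest_eq hsC) (by simp)⟩
  have hcount := Nat.count_lt_card (p := (· ∈ C)) C.finite_toSet hsC
  rwa [Finset.finite_toSet_toFinset, hC, Finset.card_map] at hcount

end Search

section Strings

theorem IsPrefixFree.eq_of_append_eq {A : Type*} {F : Set (List A)} (hF : IsPrefixFree F)
    {u v s t : List A} (hu : u ∈ F) (hv : v ∈ F) (h : u ++ s = v ++ t) : u = v := by
  rcases List.append_eq_append_iff.1 h with ⟨z, rfl, -⟩ | ⟨z, rfl, -⟩
  · by_contra hne
    exact hF u hu z (by rintro rfl; simp at hne) hv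
  · by_contra hne
    exact hF v hv z (by rintro rfl; simp at hne) hu

variable {S : Type*}

theorem IsSelfDelimiting.injective2_append [Primcodable S] {bar : List S → List S}
    (hbar : IsSelfDelimiting bar) : Function.Injective2 fun x w => bar x ++ w := by
  obtain ⟨-, ⟨hinj, -⟩, hpf⟩ := hbar
  intro x x' w w' (h : bar x ++ w = bar x' ++ w')
  have hx : bar x = bar x' := hpf.eq_of_append_eq ⟨x, rfl⟩ ⟨x', rfl⟩ h
  exact ⟨hinj hx, List.append_cancel_left (by rwa [hx] at h)⟩

theorem exists_partrec_split [Primcodable S] {code : List S → List S} (hcode : Computable code)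
    (hinj : Function.Injective2 fun x w => code x ++ w) :
    ∃ g : List S →. List S × List S, Partrec g ∧ ∀ x w, (x, w) ∈ g (code x ++ w) := by
  obtain ⟨g, hg, hmem⟩ := exists_partrec_leftInverse
    (Computable.list_append.comp (hcode.comp Computable.fst) Computable.snd) hinj.uncurry
  exact ⟨g, hg, fun x w => hmem (x, w)⟩

/-- The code `z ⋯ z o d` of the string `d`, with `|d|` copies of `z`; for `z ≠ o` it is
self-delimiting, at the cost of doubling the length. -/
def unaryLengthCode (z o : S) (d : List S) : List S :=
  List.replicate d.length z ++ o :: d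

theorem length_unaryLengthCode (z o : S) (d : List S) :
    (unaryLengthCode z o d).length = 2 * d.length + 1 := by
  simp only [unaryLengthCode, List.length_append, List.length_replicate, List.length_cons]
  ring

theorem replicate_append_cons_inj {z o : S} (hzo : z ≠ o) {m n : ℕ} {u v : List S}
    (h : List.replicate m z ++ o :: u = List.replicate n z ++ o :: v) : m = n ∧ u = v := by
  induction m generalizing n with
  | zero => cases n <;> simp_all [List.replicate_succ, eq_comm]
  | succ m ih =>
    cases n with
    | zero => simp_all [List.replicate_succ]
    | succ n =>
      obtain ⟨rfl, rfl⟩ := ih (by simpa [List.replicate_succ] using h)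
      exact ⟨rfl, rfl⟩

theorem injective2_unaryLengthCode_append {z o : S} (hzo : z ≠ o) :
    Function.Injective2 fun d w => unaryLengthCode z o d ++ w := by
  intro d d' w w' h
  simp only [unaryLengthCode, List.append_assoc, List.cons_append] at h
  obtain ⟨hlen, happ⟩ := replicate_append_cons_inj hzo h
  exact List.append_inj happ hlen

theorem primrec_unaryLengthCode [Primcodable S] (z o : S) : Primrec (unaryLengthCode z o) := by
  have hrep : Primrec fun d : List S => List.replicate d.length z :=
    (Primrec.list_map Primrec.id (Primrec.const z).to₂).of_eq fun d => List.map_const' ..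
  exact Primrec.list_append.comp hrep (Primrec.list_cons.comp (Primrec.const o) Primrec.id)

variable [Fintype S]

/-- The number with base `|S|` digits `l`, least significant first; the letters of `S` are the
digits, in an arbitrary order. -/
noncomputable def digitValue (l : List S) : ℕ :=
  Nat.ofDigits (Fintype.card S) (l.map fun s => (Fintype.equivFin S s : ℕ))

theorem primrec_digitValue [Primcodable S] : Primrec (digitValue (S := S)) := by
  have hstep : Primrec₂ fun (_ : List S) (q : S × ℕ) =>
      (Fintype.equivFin S q.1 : ℕ) + Fintype.card S * q.2 :=
    Primrec.nat_add.comp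
      ((Primrec.dom_finite fun s => (Fintype.equivFin S s : ℕ)).comp
        (Primrec.fst.comp Primrec.snd))
      (Primrec.nat_mul.comp (Primrec.const _) (Primrec.snd.comp Primrec.snd))
  refine (Primrec.list_foldr Primrec.id (Primrec.const 0) hstep).of_eq fun l => ?_
  simp only [digitValue, Nat.ofDigits_eq_foldr, List.foldr_map, id_eq, Nat.cast_id]

theorem exists_digitValue_eq [Nonempty S] (k : ℕ) {j : ℕ} (hj : j < Fintype.card S ^ k) :
    ∃ v : List S, v.length = k ∧ digitValue v = j := by
  induction k generalizing j with
  | zero => exact ⟨[], rfl, by simp_all [digitValue]⟩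
  | succ k ih =>
    obtain ⟨v, hv, hvj⟩ := ih (j := j / Fintype.card S)
      (Nat.div_lt_of_lt_mul (by rwa [← pow_succ']))
    refine ⟨(Fintype.equivFin S).symm ⟨j % Fintype.card S, Nat.mod_lt _ Fintype.card_pos⟩ :: v,
      by simp [hv], ?_⟩
    simp only [digitValue, List.map_cons, Nat.ofDigits_cons, Equiv.apply_symm_apply] at hvj ⊢
    rw [hvj, Nat.mod_add_div]

-- The pair `(t, v)` is coded as `unaryLengthCode D ++ t ++ v`, where `D` holds the digits of `|t|`.
theorem exists_partrec_unpair [Nontrivial S] [Primcodable S] :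
    ∃ g : List S →. List S × List S, Partrec g ∧ ∀ t v : List S, ∃ w, (t, v) ∈ g w ∧
      w.length = t.length + 2 * Nat.clog (Fintype.card S) (t.length + 1) + 1 + v.length := by
  obtain ⟨z, o, hzo⟩ := exists_pair_ne S
  obtain ⟨split, hsplit, hmem⟩ := exists_partrec_split (primrec_unaryLengthCode z o).to_comp
    (injective2_unaryLengthCode_append hzo)
  let cut : List S × List S → List S × List S := fun q =>
    (q.2.take (digitValue q.1), q.2.drop (digitValue q.1))
  have hlen : Primrec fun q : List S × List S => digitValue q.1 :=
    primrec_digitValue.comp Primrec.fst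
  have hcut : Primrec cut :=
    (Primrec.list_take.comp hlen Primrec.snd).pair (Primrec.list_drop.comp hlen Primrec.snd)
  refine ⟨fun w => (split w).map cut, hsplit.map (hcut.to_comp.comp Computable.snd).to₂,
    fun t v => ?_⟩
  have hlt : t.length < Fintype.card S ^ Nat.clog (Fintype.card S) (t.length + 1) :=
    Nat.le_pow_clog Fintype.one_lt_card _
  obtain ⟨D, hDlen, hDval⟩ := exists_digitValue_eq _ hlt
  refine ⟨unaryLengthCode z o D ++ (t ++ v),
    (Part.mem_map_iff _).2 ⟨_, hmem D (t ++ v), by simp [cut, hDval]⟩, ?_⟩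
  simp only [List.length_append, length_unaryLengthCode, hDlen]
  ring

end Strings

section Threshold

theorem primrec₂_pow : Primrec₂ ((· ^ ·) : ℕ → ℕ → ℕ) := by
  refine (Primrec.nat_rec (f := fun _ : ℕ => 1) (g := fun a q => q.2 * a) (Primrec.const 1)
    (Primrec.nat_mul.comp (Primrec.snd.comp Primrec.snd) Primrec.fst)).of_eq fun a n => ?_
  induction n with
  | zero => rfl
  | succ n ih => exact (congrArg (· * a) ih).trans (pow_succ a n).symm

theorem exists_nat_sub_div_add_one_eq (q : ℚ) :
    ∃ t : ℕ × ℕ × ℕ, ((t.1 : ℚ) - (t.2.1 : ℚ)) / ((t.2.2 : ℚ) + 1) = q := by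
  refine ⟨(q.num.toNat, (-q.num).toNat, q.den - 1), ?_⟩
  have hden : ((q.den - 1 : ℕ) : ℚ) + 1 = q.den := by
    exact_mod_cast Nat.sub_add_cancel q.den_pos
  have hnum : ((q.num.toNat : ℕ) : ℚ) - ((-q.num).toNat : ℕ) = q.num := by
    exact_mod_cast Int.toNat_sub_toNat_neg q.num
  rw [hden, hnum, Rat.num_div_den]

variable {S : Type*} [Primcodable S] {encQ : ℚ → List S}

theorem exists_partrec_decode_rat (hQ : Function.Injective encQ)
    (hQc : ComputableRatEncoding encQ) :
    ∃ g : List S →. ℕ × ℕ × ℕ, Partrec g ∧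
      ∀ q, ∃ t ∈ g (encQ q), ((t.1 : ℚ) - (t.2.1 : ℚ)) / ((t.2.2 : ℚ) + 1) = q := by
  obtain ⟨g, hg, hsection⟩ := exists_partrec_section hQc
  refine ⟨g, hg, fun q => ?_⟩
  obtain ⟨t, rfl⟩ := exists_nat_sub_div_add_one_eq q
  obtain ⟨t', ht', heq⟩ := hsection t
  exact ⟨t', ht', hQ heq⟩

theorem exists_partrec_lt_mul_pow (hQ : Function.Injective encQ)
    (hQc : ComputableRatEncoding encQ) (b : ℕ) :
    ∃ T : ℕ → List S →. Bool, Partrec₂ T ∧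
      ∀ k q, T k (encQ q) = Part.some (decide ((b : ℚ) < q * (b : ℚ) ^ k)) := by
  obtain ⟨g, hg, hgQ⟩ := exists_partrec_decode_rat hQ hQc
  let test : ℕ × List S → ℕ × ℕ × ℕ → Bool := fun a t =>
    decide (t.2.1 * b ^ a.1 + b * (t.2.2 + 1) < t.1 * b ^ a.1)
  have htest : Primrec₂ test := by
    have hpow : Primrec fun r : (ℕ × List S) × ℕ × ℕ × ℕ => b ^ r.1.1 :=
      primrec₂_pow.comp (Primrec.const b) (Primrec.fst.comp Primrec.fst)
    have htail : Primrec fun r : (ℕ × List S) × ℕ × ℕ × ℕ => r.2.2 :=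
      Primrec.snd.comp Primrec.snd
    exact (Primrec.nat_lt.comp
      (Primrec.nat_add.comp (Primrec.nat_mul.comp (Primrec.fst.comp htail) hpow)
        (Primrec.nat_mul.comp (Primrec.const b) (Primrec.succ.comp (Primrec.snd.comp htail))))
      (Primrec.nat_mul.comp (Primrec.fst.comp Primrec.snd) hpow)).decide
  refine ⟨fun k s => (g s).map (test (k, s)),
    (hg.comp Computable.snd).map htest.to_comp, fun k q => ?_⟩
  obtain ⟨⟨p, n, d⟩, ht, rfl⟩ := hgQ q
  refine Part.eq_some_iff.2 ((Part.mem_map_iff _).2 ⟨_, ht, ?_⟩)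
  have hpos : (0 : ℚ) < (d : ℚ) + 1 := by positivity
  rw [decide_eq_decide, div_mul_eq_mul_div, lt_div_iff₀ hpos, sub_mul, lt_sub_iff_add_lt']
  exact_mod_cast Iff.rfl

theorem exists_partrec_threshold {bar : List S → List S} (hbar : Computable bar)
    {encN : ℕ → List S} (hNc : Computable encN) (hQ : Function.Injective encQ)
    (hQc : ComputableRatEncoding encQ) {Y : Type*} {encY : Y → List S} (hY : IsEncoding encY)
    {E : Type*} {encE : E → List S} {I : E × ℕ × Y →. ℚ}
    (hI : PartialComputable (encPair bar encE (encPair bar encN encY)) encQ I) (b : ℕ) :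
    ∃ P : List S × ℕ → List S →. Bool, Partrec₂ P ∧ ∀ (e : E) (k : ℕ),
      (∀ y, ∀ q ∈ I (e, k, y),
        P (encE e, k) (encY y) = Part.some (decide ((b : ℚ) < q * (b : ℚ) ^ k))) ∧
      ∀ s ∉ Set.range encY, P (encE e, k) s = Part.some false := by
  obtain ⟨g, hg, hgI⟩ := hI
  obtain ⟨T, hT, hTQ⟩ := exists_partrec_lt_mul_pow hQ hQc b
  obtain ⟨-, _, hYdec⟩ := hY
  let test : List S × ℕ → List S →. Bool := fun a s =>
    (g (bar a.1 ++ (bar (encN a.2) ++ s))).bind (T a.2)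
  have hcode : Computable fun q : (List S × ℕ) × List S =>
      bar q.1.1 ++ (bar (encN q.1.2) ++ q.2) :=
    Computable.list_append.comp (hbar.comp (Computable.fst.comp Computable.fst))
      (Computable.list_append.comp
        (hbar.comp (hNc.comp (Computable.snd.comp Computable.fst))) Computable.snd)
  have htest : Partrec₂ test := (hg.comp hcode).bind
    (hT.comp (Computable.snd.comp (Computable.fst.comp Computable.fst)) Computable.snd)
  refine ⟨fun a s => cond (decide (s ∈ Set.range encY)) (test a s) (Part.some false),
    Partrec.cond (hYdec.comp Computable.snd) htest (Computable.const false),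
    fun e k => ⟨fun y q hq => ?_, fun s hs => by simp [hs]⟩⟩
  have hvalue : g (bar (encE e) ++ (bar (encN k) ++ encY y)) = Part.some (encQ q) := by
    have hgy := hgI (e, k, y)
    rwa [Part.eq_some_iff.2 hq, Part.map_some] at hgy
  simp only [test, Set.mem_range_self, decide_true, cond_true, hvalue]
  exact (Part.bind_some _ _).trans (hTQ k q)

end Threshold

section Approximation

theorem inv_pow_le_of_lt_mul_pow {b q g : ℝ} {k : ℕ} (hb : 2 ≤ b)
    (hqg : |q - g| < (b ^ k)⁻¹) (h : b < q * b ^ k) : (b ^ k)⁻¹ ≤ g := by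
  have hpos : 0 < b ^ k := by positivity
  have hq : b * (b ^ k)⁻¹ < q := by rwa [← div_eq_mul_inv, div_lt_iff₀ hpos]
  have h2 : 2 * (b ^ k)⁻¹ ≤ b * (b ^ k)⁻¹ := by gcongr
  linarith [(abs_lt.1 hqg).2]

theorem lt_mul_pow_of_inv_pow_le {b q g : ℝ} {m : ℕ} (hb : 2 ≤ b)
    (hqg : |q - g| < (b ^ (m + 2))⁻¹) (h : (b ^ m)⁻¹ ≤ g) : b < q * b ^ (m + 2) := by
  have hpos : 0 < b ^ (m + 2) := by positivity
  have hsq : (b ^ m)⁻¹ * b ^ (m + 2) = b ^ 2 := by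
    rw [pow_add, inv_mul_cancel_left₀ (by positivity)]
  calc b < b ^ 2 - 1 := by nlinarith
    _ = ((b ^ m)⁻¹ - (b ^ (m + 2))⁻¹) * b ^ (m + 2) := by
      rw [sub_mul, hsq, inv_mul_cancel₀ hpos.ne']
    _ ≤ q * b ^ (m + 2) := by
      gcongr
      linarith [(abs_lt.1 hqg).1]

theorem exists_finset_lt_mul_pow {Y : Type*} {g : Y → ℝ≥0∞} (hg : ∑' y, g y ≤ 1) {b : ℕ}
    (hb : 2 ≤ b) {k : ℕ} {q : Y → ℚ}
    (hq : ∀ y, |(q y : ℝ) - (g y).toReal| < ((b : ℝ) ^ k)⁻¹) :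
    ∃ T : Finset Y, T.card ≤ b ^ k ∧ ∀ y, y ∈ T ↔ (b : ℚ) < q y * (b : ℚ) ^ k := by
  have hε : ((b : ℝ≥0∞) ^ k)⁻¹ ≠ 0 :=
    ENNReal.inv_ne_zero.2 (ENNReal.pow_ne_top (ENNReal.natCast_ne_top b))
  obtain ⟨hfin, hcard⟩ :=
    ENNReal.finset_card_const_le_le_of_tsum_le ENNReal.one_ne_top hg hε
  have hsub : {y | (b : ℚ) < q y * (b : ℚ) ^ k} ⊆ {y | ((b : ℝ≥0∞) ^ k)⁻¹ ≤ g y} := by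
    intro y hy
    have hy' : (b : ℝ) < q y * (b : ℝ) ^ k := by exact_mod_cast hy
    have hle := inv_pow_le_of_lt_mul_pow (by exact_mod_cast hb) (hq y) hy'
    have hpos : (0 : ℝ) < (b : ℝ) ^ k := by positivity
    refine (ENNReal.ofReal_le_ofReal hle).trans ENNReal.ofReal_toReal_le |>.trans' ?_
    rw [ENNReal.ofReal_inv_of_pos hpos, ENNReal.ofReal_pow (by positivity),
      ENNReal.ofReal_natCast]
  refine ⟨(hfin.subset hsub).toFinset, ?_, fun y => by simp⟩
  have hcard' : (hfin.toFinset.card : ℝ≥0∞) ≤ ((b ^ k : ℕ) : ℝ≥0∞) := by simpa using hcard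
  exact (Finset.card_le_card (Set.Finite.toFinset_subset_toFinset.2 hsub)).trans
    (Nat.cast_le.1 hcard')

end Approximation

section Complexity

variable {S : Type*} [Primcodable S] {bar : List S → List S}

theorem IsUniversalConditional.exists_plainComplexity_le {U : List S →. List S}
    (hU : IsUniversalConditional bar U) {f : List S →. List S} (hf : Partrec f) :
    ∃ c : ℕ, ∀ x y w, y ∈ f (bar x ++ w) → plainComplexity bar U y x ≤ c + w.length := by
  obtain ⟨-, programs, -, -, huniv⟩ := hU
  obtain ⟨p, -, hp⟩ := huniv f hf
  exact ⟨p.length, fun x y w hy =>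
    Nat.sInf_le ⟨p ++ w, by rwa [← List.append_assoc, hp], List.length_append⟩⟩

variable [Fintype S] [Nontrivial S] {encN : ℕ → List S} {encQ : ℚ → List S} {Y L : Type*}
  {encY : Y → List S} {encE : List L → List S} {I : List L × ℕ × Y →. ℚ}

-- The program of `y` consists of `encE e` and the index of `y`, written with `m + 2` digits, in
-- the list of outputs whose approximate probability exceeds `|S| ^ (-(m + 1))`. Each of them has
-- probability at least `|S| ^ (-(m + 2))`, so there are at most `|S| ^ (m + 2)`.
theorem exists_partrec_decoder (hbar : IsSelfDelimiting bar) (hNc : Computable encN)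
    (hQ : Function.Injective encQ) (hQc : ComputableRatEncoding encQ) (hY : IsEncoding encY)
    (hI : PartialComputable (encPair bar encE (encPair bar encN encY)) encQ I) :
    ∃ f : List S →. List S, Partrec f ∧ ∀ (x : List S) (e : List L) (g : Y → ℝ≥0∞),
      ∑' y, g y ≤ 1 → IsFaithfulExplanation S I e (fun y => (g y).toReal) →
      ∀ (y : Y) (m : ℕ), ((Fintype.card S : ℝ) ^ m)⁻¹ ≤ (g y).toReal →
      ∃ w, encY y ∈ f (bar x ++ w) ∧ w.length = (encE e).length +
        2 * Nat.clog (Fintype.card S) ((encE e).length + 1) + 1 + (m + 2) := by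
  classical
  have hcard : 2 ≤ Fintype.card S := Fintype.one_lt_card
  obtain ⟨split, hsplit, hsplit_mem⟩ := exists_partrec_split hbar.1 hbar.injective2_append
  obtain ⟨unpair, hunpair, hunpair_mem⟩ := exists_partrec_unpair (S := S)
  obtain ⟨P, hP, hPI⟩ := exists_partrec_threshold hbar.1 hNc hQ hQc hY hI (Fintype.card S)
  obtain ⟨F, hF, hFP⟩ := exists_partrec_index_lt_card hP
  have hsearch : Partrec fun q : List S × List S => F (q.1, q.2.length) (digitValue q.2) :=
    hF.comp (Computable.fst.pair (Computable.list_length.comp Computable.snd))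
      (primrec_digitValue.to_comp.comp Computable.snd)
  refine ⟨fun t => ((split t).bind fun q => unpair q.2).bind fun q =>
      F (q.1, q.2.length) (digitValue q.2),
    (hsplit.bind (hunpair.comp (Computable.snd.comp Computable.snd)).to₂).bind
      (hsearch.comp Computable.snd).to₂, fun x e g hg he y m hm => ?_⟩
  choose q hqI hqg using fun y => he y (m + 2)
  obtain ⟨T, hTcard, hT⟩ := exists_finset_lt_mul_pow hg hcard hqg
  have hyT : y ∈ T := (hT y).2 (by
    exact_mod_cast lt_mul_pow_of_inv_pow_le (by exact_mod_cast hcard) (hqg y) hm)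
  have hPT : ∀ s, P (encE e, m + 2) s = Part.some (decide (s ∈ T.map ⟨encY, hY.1⟩)) := by
    intro s
    by_cases hs : s ∈ Set.range encY
    · obtain ⟨z, rfl⟩ := hs
      rw [(hPI e (m + 2)).1 z (q z) (hqI z), decide_eq_decide.2]
      simp [hT]
    · rw [(hPI e (m + 2)).2 s hs, decide_eq_false]
      rintro h
      obtain ⟨z, -, rfl⟩ := Finset.mem_map.1 h
      exact hs ⟨z, rfl⟩
  obtain ⟨j, hj, hjF⟩ := hFP _ _ hPT (encY y) (Finset.mem_map_of_mem _ hyT)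
  rw [Finset.card_map] at hj
  obtain ⟨v, hvlen, rfl⟩ := exists_digitValue_eq (m + 2) (hj.trans_le hTcard)
  obtain ⟨w, hw, hwlen⟩ := hunpair_mem (encE e) v
  refine ⟨w, Part.mem_bind (Part.mem_bind (hsplit_mem x w) hw) ?_, by rw [hwlen, hvlen]⟩
  rwa [hvlen]

/-- The base `b` length `l + 2 log (l + 1)` of a self-delimiting code for words of length `l`, up
to an additive constant. -/
noncomputable def selfDelimitedLength (b : ℕ) (l : ℝ) : ℝ :=
  l + 2 * Real.logb b (l + 1)

theorem selfDelimitedLength_mono {b : ℕ} (hb : 1 < b) {l l' : ℝ} (hl : 0 ≤ l) (h : l ≤ l') :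
    selfDelimitedLength b l ≤ selfDelimitedLength b l' := by
  have hb' : (1 : ℝ) < b := by exact_mod_cast hb
  unfold selfDelimitedLength
  gcongr

theorem selfDelimitedLength_nonneg {b : ℕ} (hb : 1 < b) {l : ℝ} (hl : 0 ≤ l) :
    0 ≤ selfDelimitedLength b l := by
  have hlog : 0 ≤ Real.logb b (l + 1) :=
    Real.logb_nonneg (by exact_mod_cast hb) (le_add_of_nonneg_left hl)
  unfold selfDelimitedLength
  positivity

theorem add_two_mul_clog_le_selfDelimitedLength {b : ℕ} (hb : 1 < b) (l : ℕ) :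
    (l : ℝ) + 2 * Nat.clog b (l + 1) ≤ selfDelimitedLength b l + 2 := by
  have hclog : (Nat.clog b (l + 1) : ℝ) < Real.logb b (l + 1) + 1 := by
    rw [← Nat.cast_add_one, ← Real.natCeil_logb_natCast]
    refine Nat.ceil_lt_add_one (Real.logb_nonneg (by exact_mod_cast hb) ?_)
    exact_mod_cast Nat.le_add_left 1 l
  unfold selfDelimitedLength
  linarith

theorem inv_pow_ceil_neg_logb_le {b : ℕ} (hb : 1 < b) {q : ℝ} (hq : 0 < q) :
    ((b : ℝ) ^ ⌈-Real.logb b q⌉₊)⁻¹ ≤ q := by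
  have hb' : (1 : ℝ) < b := by exact_mod_cast hb
  rw [← Real.rpow_natCast, ← Real.rpow_neg (by positivity), ← Real.le_logb_iff_rpow_le hb' hq]
  linarith [Nat.le_ceil (-Real.logb b q)]

theorem exists_plainComplexity_le_negLog_add (hbar : IsSelfDelimiting bar)
    {U : List S →. List S} (hU : IsUniversalConditional bar U) (hNc : Computable encN)
    (hQ : Function.Injective encQ) (hQc : ComputableRatEncoding encQ) (hY : IsEncoding encY)
    (hI : PartialComputable (encPair bar encE (encPair bar encN encY)) encQ I) :
    ∃ c : ℝ, 0 ≤ c ∧ ∀ (x : List S) (e : List L) (g : Y → ℝ≥0∞),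
      ∑' y, g y ≤ 1 → IsFaithfulExplanation S I e (fun y => (g y).toReal) → ∀ y,
      ((plainComplexity bar U (encY y) x : ℝ) : EReal) ≤ negLog (Fintype.card S) (g y) +
        (selfDelimitedLength (Fintype.card S) (encE e).length : ℝ) + (c : ℝ) := by
  obtain ⟨f, hf, hdecode⟩ := exists_partrec_decoder hbar hNc hQ hQc hY hI
  obtain ⟨c, hc⟩ := hU.exists_plainComplexity_le hf
  refine ⟨c + 6, by positivity, fun x e g hg he y => ?_⟩
  have hb : 1 < Fintype.card S := Fintype.one_lt_card
  have hgy : g y ≤ 1 := (ENNReal.le_tsum y).trans hg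
  rcases eq_or_ne (g y) 0 with h0 | h0
  · rw [negLog, if_pos h0, EReal.top_add_coe, EReal.top_add_coe]
    exact le_top
  have hpos : 0 < (g y).toReal := ENNReal.toReal_pos h0 (hgy.trans_lt ENNReal.one_lt_top).ne
  obtain ⟨w, hw, hwlen⟩ := hdecode x e g hg he y _ (inv_pow_ceil_neg_logb_le hb hpos)
  have hC : (plainComplexity bar U (encY y) x : ℝ) ≤ c + w.length := by
    exact_mod_cast hc x _ w hw
  have hlog : 0 ≤ -Real.logb (Fintype.card S) (g y).toReal :=
    neg_nonneg.2 (Real.logb_nonpos (by exact_mod_cast hb) hpos.le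
      (ENNReal.toReal_mono ENNReal.one_ne_top hgy))
  have hceil := Nat.ceil_lt_add_one hlog
  have hcode := add_two_mul_clog_le_selfDelimitedLength hb (encE e).length
  rw [negLog, if_neg h0, ← EReal.coe_add, ← EReal.coe_add, EReal.coe_le_coe_iff]
  rw [hwlen] at hC
  push_cast at hC
  linarith

end Complexity

section Expectation

theorem negLog_nonneg {b : ℕ} (hb : 1 < b) {q : ℝ≥0∞} (hq : q ≤ 1) : 0 ≤ negLog b q := by
  unfold negLog
  split_ifs with h
  · exact le_top
  · have hlog : Real.logb b q.toReal ≤ 0 :=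
      Real.logb_nonpos (by exact_mod_cast hb) ENNReal.toReal_nonneg
        (ENNReal.toReal_mono ENNReal.one_ne_top hq)
    exact_mod_cast neg_nonneg.2 hlog

variable {Z : Type*} {P : PMF Z} {F G : Z → EReal}

theorem expect_of_nonneg (hF : ∀ z ∈ P.support, 0 ≤ F z) :
    expect P F = ((∑' z, P z * (F z).toENNReal : ℝ≥0∞) : EReal) := by
  have hneg : ∑' z, P z * (-F z).toENNReal = 0 := by
    refine ENNReal.tsum_eq_zero.2 fun z => ?_
    by_cases hz : P z = 0
    · rw [hz, zero_mul]
    · rw [EReal.toENNReal_of_nonpos (EReal.neg_le_zero.2 (hF z hz)), mul_zero]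
  rw [expect, hneg, EReal.coe_ennreal_zero, sub_zero]

theorem expect_mono (hF : ∀ z ∈ P.support, 0 ≤ F z) (h : ∀ z ∈ P.support, F z ≤ G z) :
    expect P F ≤ expect P G := by
  rw [expect_of_nonneg hF, expect_of_nonneg fun z hz => (hF z hz).trans (h z hz)]
  refine EReal.coe_ennreal_le_coe_ennreal_iff.2 (ENNReal.tsum_le_tsum fun z => ?_)
  by_cases hz : P z = 0
  · simp [hz]
  · gcongr
    exact EReal.toENNReal_le_toENNReal (h z hz)

theorem expect_add (hF : ∀ z ∈ P.support, 0 ≤ F z) (hG : ∀ z ∈ P.support, 0 ≤ G z) :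
    expect P (fun z => F z + G z) = expect P F + expect P G := by
  rw [expect_of_nonneg hF, expect_of_nonneg hG,
    expect_of_nonneg fun z hz => add_nonneg (hF z hz) (hG z hz), ← EReal.coe_ennreal_add,
    ← ENNReal.tsum_add]
  refine congrArg _ (tsum_congr fun z => ?_)
  by_cases hz : P z = 0
  · simp [hz]
  · rw [EReal.toENNReal_add (hF z hz) (hG z hz), mul_add]

theorem expect_const {a : EReal} (ha : 0 ≤ a) : expect P (fun _ => a) = a := by
  rw [expect_of_nonneg fun _ _ => ha, ENNReal.tsum_mul_right, P.tsum_coe, one_mul,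
    EReal.coe_toENNReal ha]

end Expectation

section Kraft

theorem IsPrefixFree.mono {A : Type*} {F G : Set (List A)} (hG : IsPrefixFree G) (h : F ⊆ G) :
    IsPrefixFree F :=
  fun c hc z hz hcz => hG c (h hc) z hz (h hcz)

theorem IsPrefixFree.eq_singleton_nil {A : Type*} {F : Set (List A)} (hF : IsPrefixFree F)
    (hnil : [] ∈ F) : F = {[]} :=
  Set.eq_singleton_iff_unique_mem.2 ⟨hnil, fun u hu => by
    by_contra hne
    exact hF [] hnil u hne hu⟩

theorem IsPrefixFree.uniquelyDecodable {A : Type*} {F : Set (List A)} (hF : IsPrefixFree F)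
    (hnil : [] ∉ F) : InformationTheory.UniquelyDecodable F := by
  intro L₁
  induction L₁ with
  | nil =>
    rintro (_ | ⟨v, L₂⟩) _ h₂ h
    · rfl
    · obtain rfl : v = [] := (List.append_eq_nil_iff.1 h.symm).1
      exact absurd (h₂ [] List.mem_cons_self) hnil
  | cons u L₁ ih =>
    rintro (_ | ⟨v, L₂⟩) h₁ h₂ h
    · obtain rfl : u = [] := (List.append_eq_nil_iff.1 h).1
      exact absurd (h₁ [] List.mem_cons_self) hnil
    · rw [List.forall_mem_cons] at h₁ h₂
      rw [List.flatten_cons, List.flatten_cons] at h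
      obtain rfl := hF.eq_of_append_eq h₁.1 h₂.1 h
      rw [ih L₂ h₁.2 h₂.2 (List.append_cancel_left h)]

theorem IsPrefixFree.sum_pow_length_le_one {A : Type*} [Fintype A] {T : Finset (List A)}
    (hT : IsPrefixFree (T : Set (List A))) :
    ∑ u ∈ T, ((Fintype.card A : ℝ≥0∞)⁻¹) ^ u.length ≤ 1 := by
  by_cases hnil : [] ∈ T
  · rw [Finset.coe_eq_singleton.1 (hT.eq_singleton_nil hnil)]
    simp
  rcases isEmpty_or_nonempty A with hA | hA
  · rw [Finset.eq_empty_of_forall_notMem fun u hu =>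
      hnil ((Subsingleton.elim u ([] : List A)) ▸ hu)]
    simp
  have hkraft := InformationTheory.kraft_mcmillan_inequality (hT.uniquelyDecodable hnil)
  refine (ENNReal.ofReal_le_one.2 hkraft).trans_eq' ?_
  rw [ENNReal.ofReal_sum_of_nonneg fun _ _ => by positivity]
  refine Finset.sum_congr rfl fun u _ => ?_
  rw [one_div, ENNReal.ofReal_pow (by positivity),
    ENNReal.ofReal_inv_of_pos (by exact_mod_cast Fintype.card_pos), ENNReal.ofReal_natCast]

theorem IsPrefixFree.tsum_pow_length_le_one {A : Type*} [Fintype A] {F : Set (List A)}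
    (hF : IsPrefixFree F) : ∑' u : F, ((Fintype.card A : ℝ≥0∞)⁻¹) ^ u.1.length ≤ 1 := by
  rw [ENNReal.tsum_eq_iSup_sum]
  refine iSup_le fun s => ?_
  have hs : IsPrefixFree (s.map (Function.Embedding.subtype _) : Set (List A)) :=
    hF.mono (by simp)
  simpa only [Finset.sum_map] using! hs.sum_pow_length_le_one

theorem StochasticAI.tsum_prob_le_one {S X Y : Type*} [Primcodable S] [Fintype S]
    {bar : List S → List S} {encX : X → List S} {encY : Y → List S} {encN : ℕ → List S}
    {encB : Bool → List S} {encR : ∀ n : ℕ, List (Fin n) → List S}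
    (A : StochasticAI bar encX encY encN encB encR) {x : X} (hx : x ∈ A.dom) :
    ∑' y, A.prob x y ≤ 1 := by
  let forget : (Σ y, {u : List (Fin A.n) // true ∈ A.accept (u, x) ∧ y ∈ A.main (u, x)}) →
      {u | true ∈ A.accept (u, x)} := fun z => ⟨z.2.1, z.2.2.1⟩
  have hforget : Function.Injective forget := by
    rintro ⟨y, u, hu⟩ ⟨y', u', hu'⟩ h
    obtain rfl : u = u' := congrArg Subtype.val h
    obtain rfl : y = y' := Part.mem_unique hu.2 hu'.2
    rfl
  have hkraft := (A.accepted_prefixFree x hx).tsum_pow_length_le_one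
  rw [Fintype.card_fin] at hkraft
  unfold StochasticAI.prob
  rw [← ENNReal.tsum_sigma]
  exact (ENNReal.tsum_comp_le_tsum_of_injective hforget
    fun u => ((A.n : ℝ≥0∞)⁻¹) ^ u.1.length).trans hkraft

end Kraft

theorem length_encString_le {S L : Type*} [Fintype L] (encL : L → List S) (e : List L) :
    (encString encL e).length ≤ maxCodeLength encL * e.length := by
  have hle : ∀ l ∈ e.map fun a => (encL a).length, l ≤ maxCodeLength encL := by
    simp only [List.forall_mem_map]
    exact fun a _ => Finset.le_sup (f := fun a => (encL a).length) (Finset.mem_univ a)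
  have hsum := List.sum_le_card_nsmul _ _ hle
  simpa [encString, List.length_flatten, Function.comp_def, mul_comm] using hsum

theorem add_coe_neg_le_of_le_add {x y : EReal} {c : ℝ} (h : x ≤ y + c) :
    x + ((-c : ℝ) : EReal) ≤ y := by
  rw [EReal.coe_neg, ← sub_eq_add_neg]
  exact EReal.sub_le_of_le_add h

end Quadrilemma

open Quadrilemma in
theorem theorem1_general {S : Type*} [Fintype S] [Nontrivial S] [Primcodable S]
    {bar : List S → List S} (hbar : IsSelfDelimiting bar)
    {U : List S →. List S} (hU : IsUniversalConditional bar U)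
    {encN : ℕ → List S} (hNc : Computable encN)
    {encQ : ℚ → List S} (hQ : Function.Injective encQ) (hQc : ComputableRatEncoding encQ)
    {Y : Type*} {encY : Y → List S} (hY : IsEncoding encY)
    {L : Type*} [Fintype L] {encL : L → List S} {I : List L × ℕ × Y →. ℚ}
    (hI : PartialComputable (encPair bar (encString encL) (encPair bar encN encY)) encQ I) :
    ∃ c : ℝ, ∀ (X : Type*) (encX : X → List S) (D : Set X) (Q : X → Y → ℝ≥0∞),
      (∀ x ∈ D, ∑' y, Q x y ≤ 1) →
        (∀ x ∈ D, ∀ (y : Y) (e : List L),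
          IsFaithfulExplanation S I e (fun y => (Q x y).toReal) →
          ((plainComplexity bar U (encY y) (encX x) : ℝ) : EReal) + (c : EReal) ≤
            negLog (Fintype.card S) (Q x y) +
              (selfDelimitedLength (Fintype.card S) (maxCodeLength encL * e.length) : ℝ)) ∧
        (∀ e : X → List L,
          (∀ x ∈ D, IsFaithfulExplanation S I (e x) (fun y => (Q x y).toReal)) →
          ∀ P : PMF (X × Y), (∀ z ∈ P.support, z.1 ∈ D) →
          expect P (fun z => ((plainComplexity bar U (encY z.2) (encX z.1) : ℝ) : EReal)) +
              (c : EReal) ≤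
            expect P (fun z => negLog (Fintype.card S) (Q z.1 z.2)) +
              expect P (fun z => ((selfDelimitedLength (Fintype.card S)
                (maxCodeLength encL * (e z.1).length) : ℝ) : EReal))) := by
  have hb : 1 < Fintype.card S := Fintype.one_lt_card
  obtain ⟨c, hc0, hc⟩ := exists_plainComplexity_le_negLog_add hbar hU hNc hQ hQc hY hI
  refine ⟨-c, fun X encX D Q hQ1 => ?_⟩
  have hpoint : ∀ x ∈ D, ∀ (y : Y) (e : List L),
      IsFaithfulExplanation S I e (fun y => (Q x y).toReal) →
      ((plainComplexity bar U (encY y) (encX x) : ℝ) : EReal) ≤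
        negLog (Fintype.card S) (Q x y) +
          (selfDelimitedLength (Fintype.card S) (maxCodeLength encL * e.length) : ℝ) + c := by
    intro x hx y e he
    refine (hc (encX x) e (Q x) (hQ1 x hx) he y).trans ?_
    gcongr
    refine selfDelimitedLength_mono hb (Nat.cast_nonneg _) ?_
    exact_mod_cast length_encString_le encL e
  refine ⟨fun x hx y e he => add_coe_neg_le_of_le_add (hpoint x hx y e he),
    fun e he P hP => add_coe_neg_le_of_le_add ?_⟩
  have hnegLog : ∀ z ∈ P.support, 0 ≤ negLog (Fintype.card S) (Q z.1 z.2) := fun z hz =>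
    negLog_nonneg hb ((ENNReal.le_tsum z.2).trans (hQ1 z.1 (hP z hz)))
  have hlength : ∀ z ∈ P.support, (0 : EReal) ≤
      (selfDelimitedLength (Fintype.card S) (maxCodeLength encL * (e z.1).length) : ℝ) :=
    fun z _ => EReal.coe_nonneg.2 (selfDelimitedLength_nonneg hb (by positivity))
  have hc0' : (0 : EReal) ≤ (c : ℝ) := EReal.coe_nonneg.2 hc0
  rw [← expect_add hnegLog hlength, ← expect_const (P := P) hc0', ← expect_add
    (fun z hz => add_nonneg (hnegLog z hz) (hlength z hz)) fun _ _ => hc0']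
  exact expect_mono (fun z _ => EReal.coe_nonneg.2 (Nat.cast_nonneg _))
    fun z hz => hpoint z.1 (hP z hz) z.2 (e z.1) (he z.1 (hP z hz))

open Quadrilemma in
theorem theorem1
    -- the alphabet of the computation model, the pairing, and the universal machine
    {S : Type*} [Fintype S] [Nontrivial S] [Primcodable S]
    (bar : List S → List S) (hbar : IsSelfDelimiting bar)
    (U : List S →. List S) (hU : IsUniversalConditional bar U)
    -- the fixed encodings of `ℕ`, `ℚ`, `{0, 1}` and `{0, …, n - 1}*`
    (encN : ℕ → List S) (hN : IsEncoding encN) (hNc : Computable encN)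
    (encQ : ℚ → List S) (hQ : IsEncoding encQ) (hQc : ComputableRatEncoding encQ)
    (encB : Bool → List S) (hB : IsEncoding encB)
    (encR : ∀ n : ℕ, List (Fin n) → List S) (hR : ∀ n, IsEncoding (encR n))
    (hRc : ∀ n, Computable (encR n))
    -- the output space
    {Y : Type*} (encY : Y → List S) (hY : IsEncoding encY)
    -- the explanation alphabet with its prefix-free code, and the interpretation function
    {L : Type*} [Fintype L] (encL : L → List S) (hL : Function.Injective encL)
    (hLpf : IsPrefixFree (Set.range encL))
    (I : List L × ℕ × Y →. ℚ)
    (hI : PartialComputable (encPair bar (encString encL) (encPair bar encN encY)) encQ I) :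
    ∃ c : ℝ, ∀ (X : Type*) (encX : X → List S), IsEncoding encX →
      ∀ A : StochasticAI bar encX encY encN encB encR,
        (∀ x ∈ A.dom, ∀ (y : Y) (e : List L),
          IsFaithfulExplanation S I e (fun y => (A.prob x y).toReal) →
          ((plainComplexity bar U (encY y) (encX x) : ℝ) : EReal) + (c : EReal) ≤
            negLog (Fintype.card S) (A.prob x y) +
              ((maxCodeLength encL * e.length : ℝ) +
                2 * Real.logb (Fintype.card S) (maxCodeLength encL * e.length + 1) : ℝ)) ∧
        (∀ e : X → List L,
          (∀ x ∈ A.dom, IsFaithfulExplanation S I (e x) (fun y => (A.prob x y).toReal)) →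
          ∀ P : PMF (X × Y), (∀ z ∈ P.support, z.1 ∈ A.dom) →
          expect P (fun z => ((plainComplexity bar U (encY z.2) (encX z.1) : ℝ) : EReal)) +
              (c : EReal) ≤
            expect P (fun z => negLog (Fintype.card S) (A.prob z.1 z.2)) +
              expect P (fun z => (((maxCodeLength encL * (e z.1).length : ℝ) +
                2 * Real.logb (Fintype.card S) (maxCodeLength encL * (e z.1).length + 1) : ℝ) :
                  EReal))) := by
  obtain ⟨c, hc⟩ := theorem1_general hbar hU hNc hQ.1 hQc hY hI
  exact ⟨c, fun X encX _ A => hc X encX A.dom A.prob fun _ hx => A.tsum_prob_le_one hx⟩
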